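/- All spaces called compact are non-empty, compact and Hausdorff. A uniform algebra on a compact space $X$ is a uniformly closed subalgebra $A$ of $C(X)=C(X,\mathbb{C})$ that contains the constants and separates the points of $X$. A character on $A$ is a non-zero multiplicative linear functional $\varphi:A\to\mathbb{C}$ (automatically continuous); $A$ is natural on $X$ if every character on $A$ is the evaluation $f\mapsto f(x)$ at some $x\in X$. A Jensen measure for a character $\varphi$ on $A$ is a regular Borel probability measure $\mu$ on $X$ such that \[ \log|\varphi(f)|\le\int_X\log|f|\,d\mu\qquad(f\in A), \] where $\log 0=-\infty$ and both sides take values in $[-\infty,\infty)$; it is trivial if it is the point mass at some point of $X$. We say that $A$ admits no non-trivial Jensen measures if, for every character $\varphi$ on $A$, every Jensen measure for $\varphi$ with respect to $A$ is trivial. Theorem. Let $X$ and $Y$ be compact spaces, let $A$ be a uniform algebra on $X$ and $B$ a uniform algebra on $Y$, and let $\Pi:Y\to X$ be a continuous surjection such that $f\circ\Pi\in B$ for all $f\in A$ (so that $B$ is a uniform algebra extension of $A$ with associated map $\Pi$). For $x\in X$ let $B_x$ be the uniform closure in $C(\Pi^{-1}(\{x\}))$ of $\{f|_{\Pi^{-1}(\{x\})}: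 f\in B\}$, a uniform algebra on $\Pi^{-1}(\{x\})$. Suppose that $A$ admits no non-trivial Jensen measures and that, for each $x\in X$, $B_x$ admits no non-trivial Jensen measures. Then $B$ admits no non-trivial Jensen measures. In particular, $B$ is natural on $Y$. -/

import Mathlib

open MeasureTheory

namespace UniformAlgebra

/-- A subalgebra `A` of `C(X)` (it contains the constants, being a unital `ℂ`-subalgebra) is a
uniform algebra on `X` if it is uniformly closed and separates the points of `X`. For compact `X`
the (compact-open) topology on `C(X, ℂ)` is the one of the uniform norm. -/
structure IsUniformAlgebra {X : Type*} [TopologicalSpace X] (A : Subalgebra ℂ C(X, ℂ)) : Prop where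
  isClosed : IsClosed (A : Set C(X, ℂ))
  separatesPoints : A.SeparatesPoints

/-- The algebra `A_E`: the uniform closure in `C(E)` of the algebra `A|E` of restrictions to `E`
of the functions in `A`. -/
noncomputable def restrictClosure {X : Type*} [TopologicalSpace X] (A : Subalgebra ℂ C(X, ℂ))
    (E : Set X) [CompactSpace E] : Subalgebra ℂ C(E, ℂ) :=
  (A.map (ContinuousMap.compRightAlgHom ℂ ℂ
    (⟨Subtype.val, continuous_subtype_val⟩ : C(E, X)))).topologicalClosure

/-- `B` is a uniform algebra extension of `A`, with associated map `p : Y → X`. -/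
structure IsExtension {X Y : Type*} [TopologicalSpace X] [TopologicalSpace Y]
    (A : Subalgebra ℂ C(X, ℂ)) (B : Subalgebra ℂ C(Y, ℂ)) (p : C(Y, X)) : Prop where
  base : IsUniformAlgebra A
  total : IsUniformAlgebra B
  surjective : Function.Surjective p
  comp_mem : ∀ f ∈ A, f.comp p ∈ B

instance compactSpace_fibre {X Y : Type*} [TopologicalSpace X] [T1Space X] [TopologicalSpace Y]
    [CompactSpace Y] (p : C(Y, X)) (x : X) : CompactSpace (p ⁻¹' {x}) :=
  isCompact_iff_compactSpace.mp (isClosed_singleton.preimage p.continuous).isCompact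

/-- The fibre algebra `B_x` over `x`, a subalgebra of `C(p⁻¹({x}))`. -/
noncomputable def fibreAlgebra {X Y : Type*} [TopologicalSpace X] [T1Space X]
    [TopologicalSpace Y] [CompactSpace Y]
    (B : Subalgebra ℂ C(Y, ℂ)) (p : C(Y, X)) (x : X) : Subalgebra ℂ C(p ⁻¹' {x}, ℂ) :=
  restrictClosure B (p ⁻¹' {x})

/-- The extended real number `∫ log|f| dμ`, as the integral of the positive part minus the integral
of the negative part of `log|f|`, where `log 0 = -∞`. If `f` is bounded and `μ` is finite, then the
first integral is finite, so that the difference is never of the form `∞ - ∞`. -/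
noncomputable def logIntegral {X : Type*} [MeasurableSpace X] (μ : Measure X) (f : X → ℂ) : EReal :=
  ((∫⁻ x, (ENNReal.log ‖f x‖ₑ).toENNReal ∂μ : ENNReal) : EReal)
    - ((∫⁻ x, (-ENNReal.log ‖f x‖ₑ).toENNReal ∂μ : ENNReal) : EReal)

/-- `μ` is a Jensen measure for the character `φ` with respect to `A`: a regular Borel probability
measure with `log|φ(f)| ≤ ∫ log|f| dμ` for all `f ∈ A`. -/
structure IsJensenMeasure {X : Type*} [TopologicalSpace X] [MeasurableSpace X]
    (A : Subalgebra ℂ C(X, ℂ)) (φ : WeakDual.characterSpace ℂ A) (μ : Measure X) : Prop where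
  isProbabilityMeasure : IsProbabilityMeasure μ
  regular : μ.Regular
  log_le : ∀ f : A, ENNReal.log ‖φ f‖ₑ ≤ logIntegral μ (f : C(X, ℂ))

/-- `A` admits a non-trivial Jensen measure: some character of `A` has a Jensen measure that is
not a point mass. -/
def AdmitsNontrivialJensenMeasure {X : Type*} [TopologicalSpace X] [MeasurableSpace X]
    (A : Subalgebra ℂ C(X, ℂ)) : Prop :=
  ∃ (φ : WeakDual.characterSpace ℂ A) (μ : Measure X),
    IsJensenMeasure A φ μ ∧ ¬ ∃ x : X, μ = Measure.dirac x

/-- `A` is natural on `X`: every character of `A` is the evaluation at a point of `X`. -/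
def IsNatural {X : Type*} [TopologicalSpace X] (A : Subalgebra ℂ C(X, ℂ)) : Prop :=
  ∀ φ : WeakDual.characterSpace ℂ A, ∃ x : X, ∀ f : A, φ f = (f : C(X, ℂ)) x

end UniformAlgebra

namespace UniformAlgebra

open Filter Topology

/-! A Jensen measure `μ` for a character of `B` pushes forward under `p` to a Jensen measure for the
character `f ↦ φ (f ∘ p)` of `A`. That image is a point mass at some `x`, so `μ` lives on the fibre
over `x`. There `φ` is bounded by the sup norm over the fibre, hence extends to the fibre algebra,
and `μ` is a Jensen measure for the extension (`IsJensenMeasure.exists_comap`). So `μ` is a point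
mass. Naturality then follows from Bishop's theorem (`exists_isJensenMeasure`): every character has
a Jensen measure, here a point mass, and so is evaluation at that point. Since `log|f|` may be `-∞`,
everything is done with the continuous functions `log(|f| + δ)`, `δ > 0`, via `isJensenMeasure_iff`.
-/

/-! ### Regularising the logarithmic integral -/

theorem log_enorm_add_ofReal (z : ℂ) {δ : ℝ} (hδ : 0 < δ) :
    ENNReal.log (‖z‖ₑ + ENNReal.ofReal δ) = (Real.log (‖z‖ + δ) : EReal) := by
  rw [← ofReal_norm, ← ENNReal.ofReal_add (norm_nonneg z) hδ.le,
    ENNReal.log_ofReal_of_pos (by positivity)]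

theorem toENNReal_coe_real (r : ℝ) : (r : EReal).toENNReal = ENNReal.ofReal r := by
  rw [EReal.toENNReal_of_ne_top (EReal.coe_ne_top r), EReal.toReal_coe]

theorem toENNReal_log_enorm_le (z : ℂ) {δ : ℝ} (hδ : 0 < δ) :
    (ENNReal.log ‖z‖ₑ).toENNReal ≤ ENNReal.ofReal (Real.log (‖z‖ + δ)) := by
  rw [← toENNReal_coe_real, ← log_enorm_add_ofReal z hδ]
  exact EReal.toENNReal_le_toENNReal (ENNReal.log_monotone le_self_add)

/-- By `log t ≤ t - 1`, adding `δ` raises the positive part of the logarithm by at most `δ`,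
uniformly in `z`; the negative part admits no such uniform bound near `0`. -/
theorem ofReal_log_add_le (z : ℂ) {δ : ℝ} (hδ : 0 < δ) :
    ENNReal.ofReal (Real.log (‖z‖ + δ)) ≤
      (ENNReal.log ‖z‖ₑ).toENNReal + ENNReal.ofReal δ := by
  rcases le_or_gt 1 ‖z‖ with h | h
  · have hz : 0 < ‖z‖ := by linarith
    rw [← ofReal_norm z, ENNReal.log_ofReal_of_pos hz, toENNReal_coe_real,
      ← ENNReal.ofReal_add (Real.log_nonneg h) hδ.le]
    apply ENNReal.ofReal_le_ofReal
    have h1 : ‖z‖ + δ = ‖z‖ * (1 + δ / ‖z‖) := by field_simp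
    rw [h1, Real.log_mul hz.ne' (by positivity)]
    have h2 := Real.log_le_sub_one_of_pos (show 0 < 1 + δ / ‖z‖ by positivity)
    have h3 : δ / ‖z‖ ≤ δ := div_le_self hδ.le h
    linarith
  · refine (ENNReal.ofReal_le_ofReal ?_).trans le_add_self
    have := Real.log_le_sub_one_of_pos (show 0 < ‖z‖ + δ by positivity)
    linarith

theorem ofReal_neg_log_add_le (z : ℂ) {δ : ℝ} (hδ : 0 < δ) :
    ENNReal.ofReal (-Real.log (‖z‖ + δ)) ≤ (-ENNReal.log ‖z‖ₑ).toENNReal := by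
  rw [← toENNReal_coe_real, EReal.coe_neg, ← log_enorm_add_ofReal z hδ]
  exact EReal.toENNReal_le_toENNReal
    (EReal.neg_le_neg_iff.mpr (ENNReal.log_monotone le_self_add))

theorem tendsto_ofReal_neg_log_add (z : ℂ) {δ : ℕ → ℝ} (hδ : ∀ n, 0 < δ n)
    (h0 : Tendsto δ atTop (𝓝 0)) :
    Tendsto (fun n ↦ ENNReal.ofReal (-Real.log (‖z‖ + δ n))) atTop
      (𝓝 (-ENNReal.log ‖z‖ₑ).toENNReal) := by
  have h1 : ∀ n, ENNReal.ofReal (-Real.log (‖z‖ + δ n)) =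
      (-ENNReal.log (‖z‖ₑ + ENNReal.ofReal (δ n))).toENNReal := fun n ↦ by
    rw [log_enorm_add_ofReal z (hδ n), ← EReal.coe_neg, toENNReal_coe_real]
  simp_rw [h1]
  have h2 : Tendsto (fun n ↦ ‖z‖ₑ + ENNReal.ofReal (δ n)) atTop (𝓝 ‖z‖ₑ) := by
    simpa using tendsto_const_nhds (x := ‖z‖ₑ).add (ENNReal.tendsto_ofReal h0)
  have h3 : Continuous fun t : ENNReal ↦ (-ENNReal.log t).toENNReal :=
    ENNReal.continuous_log.neg.ereal_toENNReal
  exact (h3.tendsto _).comp h2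

theorem continuous_log_norm_add {X : Type*} [TopologicalSpace X] (f : C(X, ℂ)) {δ : ℝ} (hδ : 0 < δ) :
    Continuous fun x ↦ Real.log (‖f x‖ + δ) :=
  Continuous.log (by fun_prop) fun x ↦ by positivity

section

variable {X : Type*} [TopologicalSpace X] [CompactSpace X] [MeasurableSpace X]
  [BorelSpace X]

theorem integrable_of_continuous {u : X → ℝ} (hu : Continuous u) (μ : Measure X)
    [IsFiniteMeasure μ] : Integrable u μ :=
  hu.integrable_of_hasCompactSupport (HasCompactSupport.of_compactSpace u)

theorem lintegral_toENNReal_log_ne_top (μ : Measure X) [IsFiniteMeasure μ] (f : C(X, ℂ)) :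
    ∫⁻ x, (ENNReal.log ‖f x‖ₑ).toENNReal ∂μ ≠ ⊤ := by
  refine ne_top_of_le_ne_top ?_ (lintegral_mono fun x ↦ toENNReal_log_enorm_le (f x) one_pos)
  exact (integrable_of_continuous (continuous_log_norm_add f one_pos) μ).lintegral_lt_top.ne

/-- The logarithmic integral is the infimum of its regularizations. -/
theorem coe_le_logIntegral_iff (μ : Measure X) [IsProbabilityMeasure μ] (f : C(X, ℂ)) (c : ℝ) :
    (c : EReal) ≤ logIntegral μ f ↔ ∀ δ > 0, c ≤ ∫ x, Real.log (‖f x‖ + δ) ∂μ := by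
  have hP := lintegral_toENNReal_log_ne_top μ f
  unfold logIntegral
  set P := ∫⁻ x, (ENNReal.log ‖f x‖ₑ).toENNReal ∂μ
  set N := ∫⁻ x, (-ENNReal.log ‖f x‖ₑ).toENNReal ∂μ
  have hint : ∀ δ > 0, Integrable (fun x ↦ Real.log (‖f x‖ + δ)) μ := fun δ hδ ↦
    integrable_of_continuous (continuous_log_norm_add f hδ) μ
  have hneg : ∀ δ > 0, ∫⁻ x, ENNReal.ofReal (-Real.log (‖f x‖ + δ)) ∂μ ≠ ⊤ := fun δ hδ ↦
    (hint δ hδ).neg.lintegral_lt_top.ne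
  constructor
  · intro h δ hδ
    rw [integral_eq_lintegral_pos_part_sub_lintegral_neg_part (hint δ hδ),
      ← EReal.coe_le_coe_iff, EReal.coe_sub,
      EReal.coe_ennreal_toReal (hint δ hδ).lintegral_lt_top.ne,
      EReal.coe_ennreal_toReal (hneg δ hδ)]
    exact h.trans (EReal.sub_le_sub
      (EReal.coe_ennreal_le_coe_ennreal_iff.mpr
        (lintegral_mono fun x ↦ toENNReal_log_enorm_le (f x) hδ))
      (EReal.coe_ennreal_le_coe_ennreal_iff.mpr
        (lintegral_mono fun x ↦ ofReal_neg_log_add_le (f x) hδ)))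
  · intro h
    -- The positive parts cost at most `P + δ`, so the lower bound `c` controls the negative parts.
    have key : ∀ δ > 0, (∫⁻ x, ENNReal.ofReal (-Real.log (‖f x‖ + δ)) ∂μ).toReal ≤
        P.toReal + δ - c := by
      intro δ hδ
      have h1 := h δ hδ
      rw [integral_eq_lintegral_pos_part_sub_lintegral_neg_part (hint δ hδ)] at h1
      have h2 : ∫⁻ x, ENNReal.ofReal (Real.log (‖f x‖ + δ)) ∂μ ≤ P + ENNReal.ofReal δ := by
        refine (lintegral_mono fun x ↦ ofReal_log_add_le (f x) hδ).trans ?_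
        rw [lintegral_add_right _ measurable_const]
        simp [P]
      have h3 := ENNReal.toReal_mono (by finiteness) h2
      rw [ENNReal.toReal_add hP (by finiteness), ENNReal.toReal_ofReal hδ.le] at h3
      linarith
    -- Ensures that `ENNReal.ofReal (P.toReal - c)` below is not truncated at `0`.
    have hc : c ≤ P.toReal := le_of_forall_pos_le_add fun δ hδ ↦ by
      have := key δ hδ
      have : (0 : ℝ) ≤ (∫⁻ x, ENNReal.ofReal (-Real.log (‖f x‖ + δ)) ∂μ).toReal :=
        ENNReal.toReal_nonneg
      linarith
    have hδ : ∀ n : ℕ, (0 : ℝ) < 1 / ((n : ℝ) + 1) := fun n ↦ by positivity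
    have h0 := tendsto_one_div_add_atTop_nhds_zero_nat (𝕜 := ℝ)
    -- Fatou's lemma along `δ = 1 / (n + 1)`.
    have hN : N ≤ ENNReal.ofReal (P.toReal - c) := by
      calc N = ∫⁻ x, liminf (fun n : ℕ ↦
              ENNReal.ofReal (-Real.log (‖f x‖ + 1 / ((n : ℝ) + 1)))) atTop ∂μ :=
            lintegral_congr fun x ↦ (tendsto_ofReal_neg_log_add (f x) hδ h0).liminf_eq.symm
        _ ≤ liminf (fun n : ℕ ↦ ∫⁻ x,
              ENNReal.ofReal (-Real.log (‖f x‖ + 1 / ((n : ℝ) + 1))) ∂μ) atTop :=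
            lintegral_liminf_le fun n ↦
              (continuous_log_norm_add f (hδ n)).neg.measurable.ennreal_ofReal
        _ ≤ liminf (fun n : ℕ ↦ ENNReal.ofReal (P.toReal + 1 / ((n : ℝ) + 1) - c)) atTop := by
            refine liminf_le_liminf (Eventually.of_forall fun n ↦ ?_)
            exact (ENNReal.le_ofReal_iff_toReal_le (hneg _ (hδ n))
              (ENNReal.toReal_nonneg.trans (key _ (hδ n)))).mpr (key _ (hδ n))
        _ = ENNReal.ofReal (P.toReal - c) := by
            refine (ENNReal.tendsto_ofReal ?_).liminf_eq
            simpa using (tendsto_const_nhds (x := P.toReal).add h0).sub_const c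
    have hN' : N ≠ ⊤ := ne_top_of_le_ne_top ENNReal.ofReal_ne_top hN
    have hN2 := ENNReal.toReal_le_of_le_ofReal (by linarith) hN
    rw [← EReal.coe_ennreal_toReal hP, ← EReal.coe_ennreal_toReal hN', ← EReal.coe_sub,
      EReal.coe_le_coe_iff]
    linarith

theorem log_enorm_le_logIntegral_iff (μ : Measure X) [IsProbabilityMeasure μ] (f : C(X, ℂ))
    (z : ℂ) : ENNReal.log ‖z‖ₑ ≤ logIntegral μ f ↔
      ∀ δ > 0, ‖z‖ ≤ Real.exp (∫ x, Real.log (‖f x‖ + δ) ∂μ) := by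
  rcases eq_or_ne z 0 with rfl | hz
  · simp [Real.exp_nonneg]
  · have hz : 0 < ‖z‖ := norm_pos_iff.mpr hz
    rw [← ofReal_norm, ENNReal.log_ofReal_of_pos hz, coe_le_logIntegral_iff]
    simp_rw [Real.log_le_iff_le_exp hz]

/-- Jensen measures in terms of integrals of continuous functions. -/
theorem isJensenMeasure_iff (A : Subalgebra ℂ C(X, ℂ)) (φ : WeakDual.characterSpace ℂ A)
    (μ : Measure X) [IsProbabilityMeasure μ] [μ.Regular] :
    IsJensenMeasure A φ μ ↔ ∀ f : A, ∀ δ > 0,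
      ‖φ f‖ ≤ Real.exp (∫ x, Real.log (‖(f : C(X, ℂ)) x‖ + δ) ∂μ) :=
  ⟨fun h f ↦ (log_enorm_le_logIntegral_iff μ _ _).mp (h.log_le f),
    fun h ↦ ⟨inferInstance, inferInstance,
      fun f ↦ (log_enorm_le_logIntegral_iff μ _ _).mpr (h f)⟩⟩

theorem integral_log_le_of_ae_le (μ : Measure X) [IsProbabilityMeasure μ] (f : C(X, ℂ))
    {δ r : ℝ} (hδ : 0 < δ) (hf : ∀ᵐ x ∂μ, ‖f x‖ ≤ r) (hr : 0 ≤ r) :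
    Real.exp (∫ x, Real.log (‖f x‖ + δ) ∂μ) ≤ r + δ := by
  rw [← Real.le_log_iff_exp_le (by positivity)]
  refine (integral_mono_ae (integrable_of_continuous (continuous_log_norm_add f hδ) μ)
    (integrable_const (Real.log (r + δ))) ?_).trans (by simp)
  filter_upwards [hf] with x hx
  exact Real.log_le_log (by positivity) (by linarith)

/-- A character with a Jensen measure is bounded by the essential supremum. -/
theorem IsJensenMeasure.norm_le_of_ae_le {A : Subalgebra ℂ C(X, ℂ)}
    {φ : WeakDual.characterSpace ℂ A} {μ : Measure X} (h : IsJensenMeasure A φ μ) (f : A)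
    {r : ℝ} (hr : 0 ≤ r) (hf : ∀ᵐ x ∂μ, ‖(f : C(X, ℂ)) x‖ ≤ r) : ‖φ f‖ ≤ r := by
  have := h.isProbabilityMeasure
  have := h.regular
  exact le_of_forall_pos_le_add fun δ hδ ↦
    ((isJensenMeasure_iff A φ μ).mp h f δ hδ).trans (integral_log_le_of_ae_le μ _ hδ hf hr)

end


open scoped CompactlySupported

/-! ### Riesz representation on a compact space -/

theorem exists_regular_isProbabilityMeasure_integral_eq {X : Type*} [TopologicalSpace X]
    [CompactSpace X] [T2Space X] [MeasurableSpace X] [BorelSpace X] (L : C(X, ℝ) →ₗ[ℝ] ℝ)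
    (hL : ∀ u, (∀ x, 0 ≤ u x) → 0 ≤ L u) (h1 : L 1 = 1) :
    ∃ μ : Measure X, IsProbabilityMeasure μ ∧ μ.Regular ∧ ∀ u : C(X, ℝ), ∫ x, u x ∂μ = L u := by
  let e : C_c(X, ℝ) →ₗ[ℝ] C(X, ℝ) :=
    { toFun := fun u ↦ u.toContinuousMap, map_add' := fun _ _ ↦ rfl, map_smul' := fun _ _ ↦ rfl }
  let Λ : C_c(X, ℝ) →ₚ[ℝ] ℝ := PositiveLinearMap.mk₀ (L ∘ₗ e) fun u hu ↦ hL _ hu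
  have hΛ : ∀ u : C(X, ℝ), ∫ x, u x ∂(RealRMK.rieszMeasure Λ) = L u := fun u ↦
    RealRMK.integral_rieszMeasure Λ ⟨u, HasCompactSupport.of_compactSpace u⟩
  refine ⟨RealRMK.rieszMeasure Λ, ⟨?_⟩, inferInstance, hΛ⟩
  have := hΛ 1
  rw [h1] at this
  simpa [measureReal_def, ENNReal.toReal_eq_one_iff] using this

/-! ### The logarithmic cone and Bishop's theorem -/

section

variable {X : Type*} [TopologicalSpace X]

/-- The cone of all real continuous functions dominating some `n⁻¹ log|f|` with `φ f = 1`. -/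
def logCone (A : Subalgebra ℂ C(X, ℂ)) (φ : WeakDual.characterSpace ℂ A) : Set C(X, ℝ) :=
  {u | ∃ n : ℕ, 0 < n ∧ ∃ f : A, φ f = 1 ∧ ∀ x, ‖(f : C(X, ℂ)) x‖ < Real.exp (n * u x)}

variable {A : Subalgebra ℂ C(X, ℂ)} {φ : WeakDual.characterSpace ℂ A}

theorem mem_logCone_of_norm_lt {u : C(X, ℝ)} (f : A) (hf : φ f = 1)
    (h : ∀ x, ‖(f : C(X, ℂ)) x‖ < Real.exp (u x)) : u ∈ logCone A φ :=
  ⟨1, one_pos, f, hf, by simpa using h⟩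

/-- Multiplicativity of `φ` turns sums into products: `f ^ m * g ^ n` brings `1/n` and `1/m` to the
common denominator `n * m`. -/
theorem add_mem_logCone {u v : C(X, ℝ)} (hu : u ∈ logCone A φ) (hv : v ∈ logCone A φ) :
    u + v ∈ logCone A φ := by
  obtain ⟨n, hn, f, hf, hfu⟩ := hu
  obtain ⟨m, hm, g, hg, hgv⟩ := hv
  refine ⟨n * m, Nat.mul_pos hn hm, f ^ m * g ^ n, by simp [hf, hg], fun x ↦ ?_⟩
  have h1 : ‖(f : C(X, ℂ)) x‖ ^ m < Real.exp (n * u x) ^ m :=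
    pow_lt_pow_left₀ (hfu x) (norm_nonneg _) hm.ne'
  have h2 : ‖(g : C(X, ℂ)) x‖ ^ n < Real.exp (m * v x) ^ n :=
    pow_lt_pow_left₀ (hgv x) (norm_nonneg _) hn.ne'
  have h3 := mul_lt_mul'' h1 h2 (by positivity) (by positivity)
  rw [← Real.exp_nat_mul, ← Real.exp_nat_mul, ← Real.exp_add] at h3
  calc ‖((f ^ m * g ^ n : A) : C(X, ℂ)) x‖ = _ := by simp
    _ < _ := h3
    _ = _ := by
      push_cast
      rw [Pi.add_apply]
      ring_nf

theorem nat_div_smul_mem_logCone {u : C(X, ℝ)} (hu : u ∈ logCone A φ) {k m : ℕ} (hk : 0 < k)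
    (hm : 0 < m) : ((k : ℝ) / m) • u ∈ logCone A φ := by
  obtain ⟨n, hn, f, hf, hfu⟩ := hu
  refine ⟨n * m, Nat.mul_pos hn hm, f ^ k, by simp [hf], fun x ↦ ?_⟩
  have h1 : ‖(f : C(X, ℂ)) x‖ ^ k < Real.exp (n * u x) ^ k :=
    pow_lt_pow_left₀ (hfu x) (norm_nonneg _) hk.ne'
  rw [← Real.exp_nat_mul] at h1
  have hm' : (m : ℝ) ≠ 0 := by positivity
  calc ‖((f ^ k : A) : C(X, ℂ)) x‖ = _ := by simp
    _ < _ := h1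
    _ = _ := by
      push_cast
      rw [Pi.smul_apply, smul_eq_mul]
      congr 1
      field_simp

variable [CompactSpace X]

/-- A strict inequality between continuous functions on a compact space survives small uniform
perturbations. -/
theorem isOpen_logCone : IsOpen (logCone A φ) := by
  have h : logCone A φ = ⋃ (n : ℕ) (_ : 0 < n) (f : A) (_ : φ f = 1),
      {u : C(X, ℝ) | ∀ x, ‖(f : C(X, ℂ)) x‖ < Real.exp (n * u x)} := by
    ext u
    simp [logCone]
  rw [h]
  refine isOpen_iUnion fun n ↦ isOpen_iUnion fun _ ↦ isOpen_iUnion fun f ↦ isOpen_iUnion fun _ ↦ ?_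
  let g : C(X, ℝ) := ⟨fun x ↦ ‖(f : C(X, ℂ)) x‖, by fun_prop⟩
  let F : C(X, ℝ) → C(X, ℝ) := fun u ↦ (⟨Real.exp, Real.continuous_exp⟩ : C(ℝ, ℝ)).comp (n • u) - g
  have hF : Continuous F :=
    ((ContinuousMap.continuous_postcomp _).comp (continuous_const_smul n)).sub continuous_const
  have := (ContinuousMap.isOpen_setOfPred_mapsTo (isCompact_univ (X := X))
    (isOpen_Ioi (a := (0 : ℝ)))).preimage hF
  convert this using 1
  ext u
  simp [F, g, Set.MapsTo]

/-- Powers of `f` give only rational multiples. By openness `(t / q) • u` is in the cone for some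
rational `q > 0` near `t`; then multiply by `q`. -/
theorem smul_mem_logCone {u : C(X, ℝ)} (hu : u ∈ logCone A φ) {t : ℝ} (ht : 0 < t) :
    t • u ∈ logCone A φ := by
  have h1 : ∀ᶠ s in 𝓝 t, (t / s) • u ∈ logCone A φ := by
    have hc : ContinuousAt (fun s : ℝ ↦ (t / s) • u) t :=
      (continuousAt_const.div continuousAt_id ht.ne').smul continuousAt_const
    refine hc.eventually_mem (isOpen_logCone.mem_nhds ?_)
    simpa [div_self ht.ne'] using hu
  obtain ⟨V, hV, hVo, htV⟩ := mem_nhds_iff.mp (h1.and (lt_mem_nhds ht))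
  obtain ⟨q, hq⟩ := Rat.denseRange_cast.exists_mem_open hVo ⟨t, htV⟩
  obtain ⟨h2, h3⟩ := hV hq
  have hq0 : 0 < q := by exact_mod_cast h3
  have hnum : ((q.num.toNat : ℕ) : ℝ) / q.den = q := by
    have : ((q.num.toNat : ℤ) : ℝ) = q.num := by
      rw [Int.toNat_of_nonneg (Rat.num_nonneg.mpr hq0.le)]
    rw [Rat.cast_def, ← this, Int.cast_natCast]
  have h4 := nat_div_smul_mem_logCone h2 (k := q.num.toNat) (m := q.den)
    (by have := Rat.num_pos.mpr hq0; omega) q.pos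
  rwa [hnum, smul_smul, mul_div_cancel₀ _ h3.ne'] at h4

theorem convex_logCone : Convex ℝ (logCone A φ) :=
  convex_iff_forall_pos.mpr fun _ hu _ hv _ _ ha hb _ ↦
    add_mem_logCone (smul_mem_logCone hu ha) (smul_mem_logCone hv hb)

/-- Otherwise `‖f‖ < 1` with `φ f = 1`, so `f ^ k → 0` while `φ (f ^ k) = 1`. -/
theorem zero_notMem_logCone : (0 : C(X, ℝ)) ∉ logCone A φ := by
  rintro ⟨n, -, f, hf, h⟩
  have h1 : ‖f‖ < 1 := (ContinuousMap.norm_lt_iff _ one_pos).mpr (by simpa using h)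
  have h2 : Tendsto (fun k : ℕ ↦ φ (f ^ k)) atTop (𝓝 (φ 0)) :=
    ((map_continuous φ).tendsto 0).comp (tendsto_pow_atTop_nhds_zero_of_norm_lt_one h1)
  simp [hf] at h2

/-- **Bishop's theorem**: every character has a Jensen measure. -/
theorem exists_isJensenMeasure [T2Space X] [MeasurableSpace X] [BorelSpace X]
    (A : Subalgebra ℂ C(X, ℂ)) (φ : WeakDual.characterSpace ℂ A) :
    ∃ μ, IsJensenMeasure A φ μ := by
  -- Separating `0` from the cone gives `L > 0` on the cone; normalised by `L 1`, it is integration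
  -- against the required measure.
  obtain ⟨L, hL⟩ := geometric_hahn_banach_point_open (convex_logCone (A := A) (φ := φ))
    isOpen_logCone zero_notMem_logCone
  simp only [map_zero] at hL
  -- A strictly positive `u` dominates `log|1|`, so it lies in the cone.
  have hpos : ∀ u : C(X, ℝ), (∀ x, 0 < u x) → 0 < L u := fun u hu ↦
    hL u (mem_logCone_of_norm_lt 1 (map_one φ) fun x ↦ by simpa using hu x)
  have h1 : 0 < L 1 := hpos 1 fun _ ↦ one_pos
  have hnn : ∀ u : C(X, ℝ), (∀ x, 0 ≤ u x) → 0 ≤ L u := fun u hu ↦ by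
    refine le_of_forall_pos_le_add fun ε hε ↦ ?_
    have := hpos (u + (ε / L 1) • 1) fun x ↦ by
      have := hu x
      have : 0 < ε / L 1 := by positivity
      simp only [ContinuousMap.add_apply, ContinuousMap.smul_apply, ContinuousMap.one_apply,
        smul_eq_mul]
      linarith
    rw [map_add, map_smul, smul_eq_mul, div_mul_cancel₀ _ h1.ne'] at this
    exact this.le
  obtain ⟨μ, hμ, hreg, hint⟩ := exists_regular_isProbabilityMeasure_integral_eq
    ((L 1)⁻¹ • (L : C(X, ℝ) →ₗ[ℝ] ℝ))
    (fun u hu ↦ mul_nonneg (inv_nonneg.mpr h1.le) (hnn u hu)) (inv_mul_cancel₀ h1.ne')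
  refine ⟨μ, (isJensenMeasure_iff A φ μ).mpr fun f δ hδ ↦ ?_⟩
  rcases eq_or_ne (φ f) 0 with h0 | h0
  · simp [h0, Real.exp_nonneg]
  have hn : 0 < ‖φ f‖ := norm_pos_iff.mpr h0
  let w : C(X, ℝ) := ⟨fun x ↦ Real.log (‖(f : C(X, ℂ)) x‖ + δ), continuous_log_norm_add _ hδ⟩
  -- The witness is `f / φ f`; positivity of `L` here is exactly the regularised Jensen inequality.
  have hw : w - Real.log ‖φ f‖ • 1 ∈ logCone A φ := by
    refine mem_logCone_of_norm_lt ((φ f)⁻¹ • f) (by simp [h0]) fun x ↦ ?_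
    simp only [w, ContinuousMap.sub_apply, ContinuousMap.smul_apply, ContinuousMap.one_apply,
      ContinuousMap.coe_mk, smul_eq_mul, mul_one, Subalgebra.coe_smul, norm_mul, norm_inv]
    rw [Real.exp_sub, Real.exp_log (by positivity), Real.exp_log hn, inv_mul_eq_div]
    gcongr
    linarith
  have h2 := hL _ hw
  rw [map_sub, map_smul, smul_eq_mul, sub_pos] at h2
  rw [← Real.log_le_iff_le_exp hn]
  change _ ≤ ∫ x, w x ∂μ
  rw [hint w]
  change _ ≤ (L 1)⁻¹ * L w
  rw [inv_mul_eq_div, le_div_iff₀ h1]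
  exact h2.le

end


/-! ### Transporting Jensen measures to the base and to a closed subset -/

/-- A continuous unital algebra homomorphism to `ℂ`, as a character. -/
noncomputable def characterOfAlgHom {X : Type*} [TopologicalSpace X] {A : Subalgebra ℂ C(X, ℂ)}
    (ψ : A →ₐ[ℂ] ℂ) (hψ : Continuous ψ) : WeakDual.characterSpace ℂ A :=
  ⟨StrongDual.toWeakDual ⟨ψ.toLinearMap, hψ⟩,
    fun h ↦ one_ne_zero ((map_one ψ).symm.trans (DFunLike.congr_fun h 1)), map_mul ψ⟩

/-- The push-forward of a Jensen measure is a Jensen measure for the restricted character. -/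
theorem IsJensenMeasure.exists_map {X Y : Type*}
    [TopologicalSpace X] [CompactSpace X] [T2Space X] [MeasurableSpace X] [BorelSpace X]
    [TopologicalSpace Y] [CompactSpace Y] [MeasurableSpace Y] [BorelSpace Y]
    {A : Subalgebra ℂ C(X, ℂ)} {B : Subalgebra ℂ C(Y, ℂ)} (p : C(Y, X))
    (hp : ∀ f ∈ A, f.comp p ∈ B) {φ : WeakDual.characterSpace ℂ B} {μ : Measure Y}
    (h : IsJensenMeasure B φ μ) :
    ∃ ψ : WeakDual.characterSpace ℂ A, IsJensenMeasure A ψ (μ.map p) := by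
  have := h.isProbabilityMeasure
  have := h.regular
  let j : A →ₐ[ℂ] B := ((ContinuousMap.compRightAlgHom ℂ ℂ p).comp A.val).codRestrict B
    fun f ↦ hp f f.2
  have hj : Continuous j :=
    ((ContinuousMap.continuous_precomp p).comp continuous_subtype_val).subtype_mk _
  have := Measure.isProbabilityMeasure_map (μ := μ) p.continuous.aemeasurable
  have := Measure.InnerRegularCompactLTTop.map_of_continuous (μ := μ) p.continuous
  refine ⟨characterOfAlgHom ((WeakDual.CharacterSpace.toAlgHom φ).comp j) ((map_continuous φ).comp hj),
    (isJensenMeasure_iff _ _ _).mpr fun f δ hδ ↦ ?_⟩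
  rw [integral_map p.continuous.aemeasurable
    (continuous_log_norm_add _ hδ).measurable.aestronglyMeasurable]
  exact (isJensenMeasure_iff _ _ _).mp h (j f) δ hδ

/-- The restriction homomorphism from `B` to `B_E`. -/
noncomputable def restrictHom {Y : Type*} [TopologicalSpace Y] (B : Subalgebra ℂ C(Y, ℂ))
    (E : Set Y) [CompactSpace E] : B →ₐ[ℂ] restrictClosure B E :=
  ((ContinuousMap.compRightAlgHom ℂ ℂ
    (⟨Subtype.val, continuous_subtype_val⟩ : C(E, Y))).comp B.val).codRestrict _
    fun f ↦ Subalgebra.le_topologicalClosure _ ⟨f, f.2, rfl⟩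

theorem denseRange_restrictHom {Y : Type*} [TopologicalSpace Y] (B : Subalgebra ℂ C(Y, ℂ))
    (E : Set Y) [CompactSpace E] : DenseRange (restrictHom B E) := by
  rw [DenseRange, Subtype.dense_iff]
  intro g hg
  refine closure_mono ?_ hg
  rintro _ ⟨f, hf, rfl⟩
  exact ⟨restrictHom B E ⟨f, hf⟩, ⟨⟨f, hf⟩, rfl⟩, rfl⟩

/-- A homomorphism to `ℂ` dominated by the norm along a homomorphism with dense range extends. -/
theorem exists_algHom_extension {R S : Type*} [Ring R] [Algebra ℂ R] [NormedRing S]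
    [NormedAlgebra ℂ S] (r : R →ₐ[ℂ] S) (hr : DenseRange r) (φ : R →ₐ[ℂ] ℂ)
    (hφ : ∀ f, ‖φ f‖ ≤ ‖r f‖) :
    ∃ ψ : S →ₐ[ℂ] ℂ, Continuous ψ ∧ (∀ f, ψ (r f) = φ f) ∧ ∀ g, ‖ψ g‖ ≤ ‖g‖ := by
  have hdense : DenseRange r.toLinearMap := hr
  have hnorm : ∀ f, ‖φ.toLinearMap f‖ ≤ 1 * ‖r.toLinearMap f‖ := fun f ↦ by
    rw [one_mul]
    exact hφ f
  let Ψ : S →L[ℂ] ℂ := φ.toLinearMap.extendOfNorm r.toLinearMap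
  have hΨ : ∀ f, Ψ (r f) = φ f := LinearMap.extendOfNorm_eq hdense ⟨1, hnorm⟩
  have hΨn : ∀ g, ‖Ψ g‖ ≤ ‖g‖ := fun g ↦
    (LinearMap.norm_extendOfNorm_apply_le hdense 1 hnorm g).trans_eq (one_mul _)
  have hΨm : ∀ f g, Ψ (f * g) = Ψ f * Ψ g := fun f g ↦ by
    refine hr.induction_on₂ (p := fun f g ↦ Ψ (f * g) = Ψ f * Ψ g) ?_ (fun f g ↦ ?_) f g
    · exact isClosed_eq (by fun_prop) (by fun_prop)
    · rw [← map_mul r, hΨ, hΨ, hΨ, map_mul]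
  have hΨ1 : Ψ 1 = 1 := by rw [← map_one r, hΨ, map_one]
  exact ⟨AlgHom.ofLinearMap Ψ.toLinearMap hΨ1 hΨm, Ψ.continuous, hΨ, hΨn⟩

/-- A character bounded by the uniform norm on `E` extends to the closure of the restrictions
to `E`. -/
theorem exists_character_restrictClosure {Y : Type*} [TopologicalSpace Y]
    {B : Subalgebra ℂ C(Y, ℂ)} (φ : WeakDual.characterSpace ℂ B) (E : Set Y) [CompactSpace E]
    (hφ : ∀ f, ‖φ f‖ ≤ ‖restrictHom B E f‖) :
    ∃ ψ : WeakDual.characterSpace ℂ (restrictClosure B E),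
      (∀ f, ψ (restrictHom B E f) = φ f) ∧ ∀ g, ‖ψ g‖ ≤ ‖g‖ := by
  have h := exists_algHom_extension (R := B) (S := restrictClosure B E) (restrictHom B E)
  have h' := h (denseRange_restrictHom B E) (WeakDual.CharacterSpace.toAlgHom φ)
  obtain ⟨ψ, hc, hψ, hψn⟩ := h' hφ
  exact ⟨characterOfAlgHom ψ hc, fun f ↦ hψ f, fun g ↦ hψn g⟩

/-- A Jensen measure concentrated on `E` restricts to a Jensen measure for a character of the
closure of the restrictions to `E`. -/
theorem IsJensenMeasure.exists_comap {Y : Type*}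
    [TopologicalSpace Y] [CompactSpace Y] [T2Space Y] [MeasurableSpace Y] [BorelSpace Y]
    {B : Subalgebra ℂ C(Y, ℂ)} {φ : WeakDual.characterSpace ℂ B} {μ : Measure Y}
    (h : IsJensenMeasure B φ μ) (E : Set Y) [CompactSpace E] (hμE : ∀ᵐ y ∂μ, y ∈ E) :
    ∃ ψ : WeakDual.characterSpace ℂ (restrictClosure B E),
      IsJensenMeasure (restrictClosure B E) ψ (μ.comap Subtype.val) := by
  have := h.isProbabilityMeasure
  have := h.regular
  have hE : IsClosed E := (isCompact_iff_compactSpace.mpr ‹_›).isClosed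
  have hemb : MeasurableEmbedding (Subtype.val : E → Y) :=
    MeasurableEmbedding.subtype_coe hE.measurableSet
  have hmap : (μ.comap (Subtype.val : E → Y)).map Subtype.val = μ := by
    rw [hemb.map_comap, Subtype.range_coe, Measure.restrict_eq_self_of_ae_mem hμE]
  have hprob : IsProbabilityMeasure (μ.comap (Subtype.val : E → Y)) := by
    refine ⟨?_⟩
    rw [← Set.preimage_univ (f := (Subtype.val : E → Y)), ← hemb.map_apply, hmap, measure_univ]
  have hreg : (μ.comap (Subtype.val : E → Y)).InnerRegular :=
    ⟨(Measure.InnerRegular.innerRegular (μ := μ)).comap hemb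
      (fun _ hU ↦ hemb.measurableSet_image' hU)
      fun _ _ hK ↦ hE.isClosedEmbedding_subtypeVal.isCompact_preimage hK⟩
  -- As `μ` is carried by `E`, the essential supremum of `|f|` is at most its sup norm on `E`.
  obtain ⟨ψ, hψ, hψn⟩ := exists_character_restrictClosure φ E fun f ↦ by
    refine h.norm_le_of_ae_le f (norm_nonneg _) ?_
    filter_upwards [hμE] with y hy
    exact (restrictHom B E f : C(E, ℂ)).norm_coe_le_norm ⟨y, hy⟩
  refine ⟨ψ, (isJensenMeasure_iff _ _ _).mpr fun g δ hδ ↦ le_of_forall_pos_le_add fun ε hε ↦ ?_⟩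
  -- Closeness `ε` controls `ψ g - φ f`; closeness `δ / 2` gives `|f| + δ / 2 ≤ |g| + δ` on `E`, so
  -- the approximation error is absorbed inside the logarithm.
  obtain ⟨f, hf⟩ := (denseRange_restrictHom B E).exists_dist_lt g
    (show 0 < min ε (δ / 2) by positivity)
  rw [dist_eq_norm] at hf
  have h1 : ‖ψ g‖ ≤ ‖φ f‖ + ε := by
    have h2 := hψn (g - restrictHom B E f)
    rw [map_sub, hψ] at h2
    have h3 := norm_le_norm_add_norm_sub' (ψ g) (φ f)
    have h4 := hf.trans_le (min_le_left _ _)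
    linarith
  refine h1.trans (add_le_add_left ?_ ε)
  refine ((isJensenMeasure_iff _ _ _).mp h f (δ / 2) (half_pos hδ)).trans
    (Real.exp_le_exp.mpr ?_)
  rw [← hmap, hemb.integral_map, hmap]
  refine integral_mono
    (integrable_of_continuous
      (continuous_log_norm_add (restrictHom B E f : C(E, ℂ)) (half_pos hδ)) _)
    (integrable_of_continuous (continuous_log_norm_add _ hδ) _) fun y ↦ ?_
  refine Real.log_le_log (by positivity) ?_
  have h5 : ‖(g : C(E, ℂ)) y - (f : C(Y, ℂ)) y‖ ≤ ‖g - restrictHom B E f‖ :=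
    (g - restrictHom B E f : C(E, ℂ)).norm_coe_le_norm y
  have h6 := norm_le_norm_add_norm_sub ((g : C(E, ℂ)) y) ((f : C(Y, ℂ)) y)
  have h7 := hf.trans_le (min_le_right _ _)
  linarith

/-! ### Triviality of Jensen measures on the extension, and naturality -/

theorem IsExtension.not_admitsNontrivialJensenMeasure {X Y : Type*}
    [TopologicalSpace X] [CompactSpace X] [T2Space X] [MeasurableSpace X] [BorelSpace X]
    [TopologicalSpace Y] [CompactSpace Y] [T2Space Y] [MeasurableSpace Y] [BorelSpace Y]
    {A : Subalgebra ℂ C(X, ℂ)} {B : Subalgebra ℂ C(Y, ℂ)} {p : C(Y, X)}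
    (hAB : IsExtension A B p) (hA : ¬ AdmitsNontrivialJensenMeasure A)
    (hB : ∀ x : X, ¬ AdmitsNontrivialJensenMeasure (fibreAlgebra B p x)) :
    ¬ AdmitsNontrivialJensenMeasure B := by
  rintro ⟨φ, μ, hμ, hne⟩
  obtain ⟨ψ, hψ⟩ := hμ.exists_map p hAB.comp_mem
  obtain ⟨x, hx⟩ : ∃ x, μ.map p = Measure.dirac x := by
    by_contra hx
    exact hA ⟨ψ, _, hψ, hx⟩
  have hae : ∀ᵐ y ∂μ, y ∈ p ⁻¹' {x} := by
    refine ae_of_ae_map (p := fun z ↦ z ∈ ({x} : Set X)) p.continuous.aemeasurable ?_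
    rw [hx, ae_dirac_eq]
    exact Set.mem_singleton x
  obtain ⟨χ, hχ⟩ := hμ.exists_comap (p ⁻¹' {x}) hae
  obtain ⟨y, hy⟩ : ∃ y, μ.comap (Subtype.val : p ⁻¹' {x} → Y) = Measure.dirac y := by
    by_contra hy
    exact hB x ⟨χ, _, hχ, hy⟩
  refine hne ⟨y, ?_⟩
  have hE : MeasurableSet (p ⁻¹' {x}) := (isClosed_singleton.preimage p.continuous).measurableSet
  have hdirac := Measure.map_dirac' (measurable_subtype_coe (p := (· ∈ p ⁻¹' {x}))) y
  -- Pushing the point mass on the fibre forward to `Y` recovers `μ`, since `μ` is carried by the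
  -- fibre.
  rw [← hdirac, ← hy,
    (MeasurableEmbedding.subtype_coe hE).map_comap, Subtype.range_coe,
    Measure.restrict_eq_self_of_ae_mem hae]

theorem isNatural_of_not_admitsNontrivialJensenMeasure {X : Type*}
    [TopologicalSpace X] [CompactSpace X] [T2Space X] [MeasurableSpace X] [BorelSpace X]
    {A : Subalgebra ℂ C(X, ℂ)} (hA : ¬ AdmitsNontrivialJensenMeasure A) : IsNatural A := by
  intro φ
  obtain ⟨μ, hμ⟩ := exists_isJensenMeasure A φ
  obtain ⟨x, rfl⟩ : ∃ x, μ = Measure.dirac x := by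
    by_contra hx
    exact hA ⟨φ, μ, hμ, hx⟩
  refine ⟨x, fun f ↦ ?_⟩
  -- The function `f - f(x)` vanishes almost everywhere for the point mass at `x`, so `φ` kills it.
  have h := hμ.norm_le_of_ae_le (f - algebraMap ℂ A ((f : C(X, ℂ)) x)) le_rfl (by
    rw [ae_dirac_eq]
    change ‖(f : C(X, ℂ)) x - algebraMap ℂ ℂ ((f : C(X, ℂ)) x)‖ ≤ 0
    simp)
  rw [norm_le_zero_iff, map_sub, AlgHomClass.commutes, sub_eq_zero] at h
  exact h

end UniformAlgebra

theorem mainTheorem3 {X : Type*} {Y : Type*}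
    [TopologicalSpace X] [CompactSpace X] [T2Space X] [Nonempty X]
    [MeasurableSpace X] [BorelSpace X]
    [TopologicalSpace Y] [CompactSpace Y] [T2Space Y] [Nonempty Y]
    [MeasurableSpace Y] [BorelSpace Y]
    (A : Subalgebra ℂ C(X, ℂ)) (B : Subalgebra ℂ C(Y, ℂ)) (p : C(Y, X))
    (hAB : UniformAlgebra.IsExtension A B p)
    (hA : ¬ UniformAlgebra.AdmitsNontrivialJensenMeasure A)
    (hB : ∀ x : X, ¬ UniformAlgebra.AdmitsNontrivialJensenMeasure
      (UniformAlgebra.fibreAlgebra B p x)) :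
    ¬ UniformAlgebra.AdmitsNontrivialJensenMeasure B ∧ UniformAlgebra.IsNatural B := 
  have h := hAB.not_admitsNontrivialJensenMeasure hA hB
  ⟨h, UniformAlgebra.isNatural_of_not_admitsNontrivialJensenMeasure h⟩
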